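/- Let $\mathbb{S}^3=\{(z_1,z_2)\in\mathbb{C}^2 : |z_1|^2+|z_2|^2=1\}$, $z_j=x_j+\mathrm{i}y_j$, carry the round metric and the orientation of the boundary of the unit ball of $\mathbb{R}^4=\{(x_1,y_1,x_2,y_2)\}$, and write points in Hopf coordinates as $(z_1,z_2)=(\cos s\,e^{\mathrm{i}\phi_1},\sin s\,e^{\mathrm{i}\phi_2})$, $s\in[0,\pi/2]$. Let $\xi=\partial_{\phi_1}+\partial_{\phi_2}$ and $\xi'=\partial_{\phi_1}-\partial_{\phi_2}$ be the Hopf and anti-Hopf fields, and let $\phi$ be the $(1,1)$-tensor $\phi(X)=-\nabla_X\xi$ of the standard Sasakian structure, where $\nabla$ is the Levi-Civita connection. A smooth vector field $u$ on $\mathbb{S}^3$ is a *steady Euler field* if $\operatorname{div}u=0$ and $\nabla_u u=-\operatorname{grad}p$ for some smooth function $p$ (a pressure); then $b=p+\tfrac12|u|^2$ is a *Bernoulli function* of $u$, and $u\times\operatorname{curl}u=\operatorname{grad}b$, where $\operatorname{curl}u=(\ast\,\mathrm{d}u^\flat)^\sharp$. A steady Euler field is *localizable* if $u(|u|^2)=0$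 everywhere. A *KKPS field* is a vector field $A(\cos^2 s)\,\xi+B(\cos^2 s)\,\xi'$ with smooth $A,B:\mathbb{R}\to\mathbb{R}$. Vector fields $u,v$ are *related by an isometry* if there is a Riemannian isometry $\Phi$ of $\mathbb{S}^3$ with $\mathrm{d}\Phi(u)=v\circ\Phi$. Let $F:\mathbb{R}\to\mathbb{R}$ be smooth, let $a\ge 0$, and put $$\psi_a=\tfrac14\bigl(3+\cos 4s+2a\sin^2 2s\,\cos 2(\phi_1-\phi_2)\bigr),\qquad u_a=F(\psi_a)\,\xi+\phi(\operatorname{grad}\psi_a).$$ **Proposition.** (i) For every $a\ge0$, $u_a$ is a steady Euler field on $\mathbb{S}^3$ with Bernoulli function $$b=\tfrac12F(\psi_a)^2-12\psi_a^2+16\psi_a-2\int_0^{\psi_a}F(q)\,dq ,$$ and $u_a\times\operatorname{curl}u_a=\operatorname{grad}b$. In particular, if $F(x)=2(3x-2)$, then $u_a$ is an eigenvector of the curl operator with eigenvalue $6$: $u_a\not\equiv0$ and $\operatorname{curl}u_a=6u_a$. (ii) If $a=0$, then $u_a$ is a KKPS field (and a steady Euler field). If $a=1$, then $u_a$ is related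 by an isometry to a KKPS field that is a steady Euler field. (iii) If $a\neq0,1$, then $u_a$ is not localizable, and there is no isometry relating $u_a$ to any KKPS field. -/

import Mathlib

open scoped Manifold ContDiff

namespace SphereEuler

noncomputable section

/-! ### The round 3-sphere in `ℝ⁴`

Coordinates are `(x₁, y₁, x₂, y₂) = (p 0, p 1, p 2, p 3)`.  The tangent space `T_p S³` is the
hyperplane `p^⊥` of `ℝ⁴`, with the inner product of `ℝ⁴`; a vector field on `S³` is a map
`u : S³ → ℝ⁴` with `u p ⟂ p` for every `p`. -/

/-- `ℝ⁴` with its Euclidean inner product. -/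
abbrev E4 : Type := EuclideanSpace ℝ (Fin (3 + 1))

/-- The unit sphere of `ℝ⁴`, with the smooth structure that Mathlib puts on it. -/
abbrev S3 : Type := Metric.sphere (0 : E4) 1

/-- The radial retraction `x ↦ x / ‖x‖` of `ℝ⁴ ∖ {0}` onto `S³` (with a dummy value at `0`). -/
def toSphere (x : E4) : S3 :=
  if h : x = 0 then ⟨EuclideanSpace.single 0 1, by simp⟩
  else ⟨‖x‖⁻¹ • x, by simp [norm_smul, norm_ne_zero_iff.mpr h]⟩

/-- Degree zero homogeneous extension to `ℝ⁴ ∖ {0}` of a map defined on `S³`. -/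
def radial {V : Type*} (f : S3 → V) (x : E4) : V := f (toSphere x)

/-- The differential of a map `f : S³ → V` at `p`, evaluated at tangent vectors `w ∈ p^⊥`:
the derivative of the homogeneous extension of `f`, which vanishes in the direction of `p`.
(For smooth `f` this is Mathlib's manifold derivative, see `mfderiv_eq_sphereD`.) -/
def sphereD {V : Type*} [NormedAddCommGroup V] [NormedSpace ℝ V] (f : S3 → V) (p : S3) :
    E4 →L[ℝ] V :=
  fderiv ℝ (radial f) (p : E4)

theorem toSphere_coe (p : S3) : toSphere (p : E4) = p := by
  have hp : ‖(p : E4)‖ = 1 := norm_eq_of_mem_sphere p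
  have h0 : (p : E4) ≠ 0 := fun h => by simp [h] at hp
  apply Subtype.ext
  simp [toSphere, h0, hp]

theorem contMDiffAt_toSphere {x : E4} (hx : x ≠ 0) :
    ContMDiffAt 𝓘(ℝ, E4) (𝓡 3) ∞ toSphere x := by
  have : Fact (Module.finrank ℝ E4 = 3 + 1) := ⟨finrank_euclideanSpace_fin⟩
  let U : TopologicalSpace.Opens E4 := ⟨{0}ᶜ, isOpen_compl_singleton⟩
  have hU : ∀ y : U, (y : E4) ≠ 0 := fun y => y.2
  have h1 : ContMDiff 𝓘(ℝ, E4) 𝓘(ℝ, E4) ∞ (fun y : U => ‖(y : E4)‖⁻¹ • (y : E4)) := by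
    intro y
    refine (contMDiffAt_subtype_iff (f := fun z : E4 => ‖z‖⁻¹ • z)).2 (ContDiffAt.contMDiffAt ?_)
    exact ((contDiffAt_norm ℝ (hU y)).inv (norm_ne_zero_iff.2 (hU y))).smul contDiffAt_id
  have h2 := h1.codRestrict_sphere (n := 3)
    (fun y => by simp [norm_smul, norm_ne_zero_iff.mpr (hU y)])
  refine (contMDiffAt_subtype_iff (U := U) (x := ⟨x, hx⟩)).1 ?_
  refine (h2 ⟨x, hx⟩).congr_of_eventuallyEq (Filter.Eventually.of_forall fun y => ?_)
  apply Subtype.ext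
  simp [toSphere, hU y, Set.codRestrict]

/-- `sphereD` is the manifold derivative, once `T_p S³` is identified with `p^⊥` by means of the
derivative of the inclusion `S³ → ℝ⁴`. -/
theorem mfderiv_eq_sphereD {V : Type*} [NormedAddCommGroup V] [NormedSpace ℝ V] {f : S3 → V}
    {p : S3} (hf : MDifferentiableAt (𝓡 3) 𝓘(ℝ, V) f p) (v : TangentSpace (𝓡 3) p) :
    mfderiv (𝓡 3) 𝓘(ℝ, V) f p v =
      sphereD f p (mfderiv (𝓡 3) 𝓘(ℝ, E4) (fun q : S3 => (q : E4)) p v) := by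
  have : Fact (Module.finrank ℝ E4 = 3 + 1) := ⟨finrank_euclideanSpace_fin⟩
  have hp : (p : E4) ≠ 0 := fun h => by simpa [h] using norm_eq_of_mem_sphere p
  have h1 : MDifferentiableAt 𝓘(ℝ, E4) (𝓡 3) toSphere (p : E4) :=
    (contMDiffAt_toSphere hp).mdifferentiableAt (by simp)
  have h2 : MDifferentiableAt 𝓘(ℝ, E4) 𝓘(ℝ, V) (radial f) (p : E4) :=
    MDifferentiableAt.comp (I' := 𝓡 3) (p : E4) (by rwa [toSphere_coe]) h1
  have h3 : MDifferentiableAt (𝓡 3) 𝓘(ℝ, E4) (fun q : S3 => (q : E4)) p :=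
    (contMDiff_coe_sphere (m := ∞) p).mdifferentiableAt (by simp)
  have h4 : f = radial f ∘ fun q : S3 => (q : E4) := by
    funext q
    simp [radial, toSphere_coe]
  conv_lhs => rw [h4]
  rw [mfderiv_comp (I' := 𝓘(ℝ, E4)) p h2 h3]
  rw [mfderiv_eq_fderiv]
  rfl

/-- A smooth tangent vector field on `S³`. -/
structure IsVectorField (u : S3 → E4) : Prop where
  tangent : ∀ p : S3, inner ℝ (p : E4) (u p) = 0
  smooth : ContMDiff (𝓡 3) 𝓘(ℝ, E4) ∞ u

/-- The Levi-Civita connection of the round metric: `∇_w Y` at `p` is the orthogonal projection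
to `T_p S³ = p^⊥` of the derivative of `Y` in the direction of `w`. -/
def nabla (w : E4) (Y : S3 → E4) (p : S3) : E4 :=
  sphereD Y p w - inner ℝ (p : E4) (sphereD Y p w) • (p : E4)

/-- The Riemannian gradient: the tangent vector with `⟪grad f, w⟫ = df(w)`. -/
def grad (f : S3 → ℝ) (p : S3) : E4 :=
  (InnerProductSpace.toDual ℝ E4).symm (sphereD f p)

/-! ### The standard frame -/

/-- The Hopf field `ξ = ∂_{φ₁} + ∂_{φ₂}`, the Reeb field of the standard Sasakian structure. -/
def xi (p : S3) : E4 := !₂[-p.1 1, p.1 0, -p.1 3, p.1 2]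

/-- The field `X₁` of the standard frame. -/
def X1 (p : S3) : E4 := !₂[-p.1 2, p.1 3, p.1 0, -p.1 1]

/-- The field `X₂` of the standard frame. -/
def X2 (p : S3) : E4 := !₂[-p.1 3, -p.1 2, p.1 1, p.1 0]

/-- The anti-Hopf field `ξ' = ∂_{φ₁} - ∂_{φ₂}`. -/
def xi' (p : S3) : E4 := !₂[-p.1 1, p.1 0, p.1 3, -p.1 2]

/-- The standard frame `(ξ, X₁, X₂)`. -/
def frame (i : Fin 3) (p : S3) : E4 := ![xi p, X1 p, X2 p] i

/-- The Riemannian volume form of `S³`, oriented as the boundary of the ball in `ℝ⁴`. -/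
def vol (p : S3) (v w z : E4) : ℝ :=
  (Matrix.of fun i j : Fin 4 => (![(p : E4), v, w, z] i) j).det

theorem sq_sum (p : S3) : p.1 0 ^ 2 + p.1 1 ^ 2 + p.1 2 ^ 2 + p.1 3 ^ 2 = 1 := by
  have h := EuclideanSpace.norm_sq_eq p.1
  rw [norm_eq_of_mem_sphere p] at h
  simp [Fin.sum_univ_four] at h
  linarith

/-- The standard frame is orthonormal, tangent, and positively oriented. -/
theorem frame_orthonormal (p : S3) :
    Orthonormal ℝ (fun i => frame i p) ∧ (∀ i, inner ℝ (p : E4) (frame i p) = 0) ∧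
      vol p (xi p) (X1 p) (X2 p) = 1 := by
  have hp : p.1 0 ^ 2 + p.1 1 ^ 2 + p.1 2 ^ 2 + p.1 3 ^ 2 = 1 := sq_sum p
  refine ⟨?_, ?_, ?_⟩
  · rw [orthonormal_iff_ite]
    intro i j
    rw [PiLp.inner_apply]
    fin_cases i <;> fin_cases j <;>
      simp [frame, xi, X1, X2, Fin.sum_univ_four] <;> linarith
  · intro i
    fin_cases i <;> simp [frame, xi, X1, X2, PiLp.inner_apply, Fin.sum_univ_four] <;> ring
  · have h2 : vol p (xi p) (X1 p) (X2 p) =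
        (p.1 0 ^ 2 + p.1 1 ^ 2 + p.1 2 ^ 2 + p.1 3 ^ 2) ^ 2 := by
      simp [vol, xi, X1, X2, Matrix.det_succ_row_zero, Fin.sum_univ_succ, Fin.succAbove]
      ring
    rw [h2, hp]
    norm_num

/-! ### Vector calculus on `S³` -/

/-- The divergence, the trace of `w ↦ ∇_w u`. -/
def divergence (u : S3 → E4) (p : S3) : ℝ :=
  ∑ i, inner ℝ (nabla (frame i p) u p) (frame i p)

/-- The 2-form `du♭` on tangent vectors: `du♭(v, w) = ⟪D_v u, w⟫ - ⟪D_w u, v⟫`. -/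
def dFlat (u : S3 → E4) (p : S3) (v w : E4) : ℝ :=
  inner ℝ (sphereD u p v) w - inner ℝ (sphereD u p w) v

/-- The curl `(⋆ du♭)^♯`: in an oriented orthonormal frame `(E₀, E₁, E₂)` its `i`-th component is
`du♭(E_{i+1}, E_{i+2})`, indices being taken modulo 3. -/
def curl (u : S3 → E4) (p : S3) : E4 :=
  ∑ i, dFlat u p (frame (i + 1) p) (frame (i + 2) p) • frame i p

/-- The cross product of tangent vectors at `p`: `⟪v × w, z⟫ = vol(v, w, z)` for `z ∈ T_p S³`. -/
def cross (p : S3) (v w : E4) : E4 := ∑ i, vol p v w (frame i p) • frame i p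

/-- The transverse complex structure of the standard Sasakian structure, `φ w = -∇_w ξ`. -/
def phi (p : S3) (w : E4) : E4 := -nabla w xi p

/-! ### Steady Euler fields -/

/-- `π` is a (smooth) pressure function of `u`: `∇_u u = - grad π`. -/
structure IsPressure (u : S3 → E4) (π : S3 → ℝ) : Prop where
  smooth : ContMDiff (𝓡 3) 𝓘(ℝ, ℝ) ∞ π
  euler : ∀ p, nabla (u p) u p = -grad π p

/-- A steady Euler field: `∇_u u = - grad π` for some pressure `π`, and `div u = 0`. -/
structure IsSteadyEuler (u : S3 → E4) : Prop where
  isVectorField : IsVectorField u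
  exists_pressure : ∃ π : S3 → ℝ, IsPressure u π
  div_eq_zero : ∀ p, divergence u p = 0

/-- `b` is a Bernoulli function of `u`: `b = π + |u|² / 2` for a pressure function `π`. -/
def IsBernoulli (u : S3 → E4) (b : S3 → ℝ) : Prop :=
  ∃ π : S3 → ℝ, IsPressure u π ∧ ∀ p, b p = π p + 1 / 2 * ‖u p‖ ^ 2

/-- A localizable steady Euler field: `u(|u|²) = 0` everywhere. -/
structure IsLocalizable (u : S3 → E4) : Prop where
  isSteadyEuler : IsSteadyEuler u
  conserved : ∀ p, sphereD (fun q => ‖u q‖ ^ 2) p (u p) = 0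

/-- `u` is an eigenvector of the curl operator with eigenvalue `μ`. -/
structure IsCurlEigenfield (u : S3 → E4) (μ : ℝ) : Prop where
  isVectorField : IsVectorField u
  ne_zero : u ≠ 0
  curl_eq : ∀ p, curl u p = μ • u p

/-- A Riemannian isometry of `S³`: a diffeomorphism whose differential preserves the metric. -/
def IsIsometry (Φ : S3 ≃ₘ^∞⟮𝓡 3, 𝓡 3⟯ S3) : Prop :=
  ∀ (p : S3) (v w : E4), inner ℝ (p : E4) v = 0 → inner ℝ (p : E4) w = 0 →
    inner ℝ (sphereD (fun q => (Φ q : E4)) p v) (sphereD (fun q => (Φ q : E4)) p w) = inner ℝ v w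

/-- `u` and `v` are related by an isometry `Φ` of `S³`: `dΦ(u) = v ∘ Φ`. -/
def IsometricallyRelated (u v : S3 → E4) : Prop :=
  ∃ Φ : S3 ≃ₘ^∞⟮𝓡 3, 𝓡 3⟯ S3, IsIsometry Φ ∧
    ∀ p, sphereD (fun q => (Φ q : E4)) p (u p) = v (Φ p)

/-! ### Hopf coordinates, the KKPS family and the fields `u_a` -/

/-- The first complex coordinate. -/
def z1 (p : S3) : ℂ := ⟨p.1 0, p.1 1⟩

/-- The second complex coordinate. -/
def z2 (p : S3) : ℂ := ⟨p.1 2, p.1 3⟩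

/-- The Hopf coordinate `s ∈ [0, π/2]`, with `|z₁| = cos s` and `|z₂| = sin s`. -/
def hopfS (p : S3) : ℝ := Real.arccos ‖z1 p‖

/-- The Hopf coordinate `φ₁` (an argument of `z₁`). -/
def hopfPhi1 (p : S3) : ℝ := Complex.arg (z1 p)

/-- The Hopf coordinate `φ₂` (an argument of `z₂`). -/
def hopfPhi2 (p : S3) : ℝ := Complex.arg (z2 p)

/-- The KKPS family: `u = A(cos² s) ξ + B(cos² s) ξ'` with smooth `A`, `B`. -/
def IsKKPS (u : S3 → E4) : Prop :=
  ∃ A B : ℝ → ℝ, ContDiff ℝ ∞ A ∧ ContDiff ℝ ∞ B ∧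
    ∀ p, u p = A (Real.cos (hopfS p) ^ 2) • xi p + B (Real.cos (hopfS p) ^ 2) • xi' p

/-- `ψ_a = ¼ (3 + cos 4s + 2a sin² 2s cos 2(φ₁ - φ₂))`. -/
def psi (a : ℝ) (p : S3) : ℝ :=
  1 / 4 * (3 + Real.cos (4 * hopfS p) +
    2 * a * Real.sin (2 * hopfS p) ^ 2 * Real.cos (2 * (hopfPhi1 p - hopfPhi2 p)))

/-- Sanity check: `ψ_a` in Cartesian coordinates, as the restriction of a polynomial. -/
theorem psi_eq (a : ℝ) (p : S3) :
    psi a p = 1 - 2 * (p.1 0 ^ 2 + p.1 1 ^ 2) * (p.1 2 ^ 2 + p.1 3 ^ 2) +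
      2 * a * ((p.1 0 * p.1 2 + p.1 1 * p.1 3) ^ 2 - (p.1 1 * p.1 2 - p.1 0 * p.1 3) ^ 2) := by
  have hsum := sq_sum p
  set r := ‖z1 p‖ with hr
  set t := ‖z2 p‖ with ht
  have h1 : r * Real.cos (hopfPhi1 p) = p.1 0 := Complex.norm_mul_cos_arg _
  have h2 : r * Real.sin (hopfPhi1 p) = p.1 1 := Complex.norm_mul_sin_arg _
  have h3 : t * Real.cos (hopfPhi2 p) = p.1 2 := Complex.norm_mul_cos_arg _
  have h4 : t * Real.sin (hopfPhi2 p) = p.1 3 := Complex.norm_mul_sin_arg _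
  have hr2 : r ^ 2 = p.1 0 ^ 2 + p.1 1 ^ 2 := by
    rw [← h1, ← h2]; linear_combination -r ^ 2 * Real.sin_sq_add_cos_sq (hopfPhi1 p)
  have ht2 : t ^ 2 = p.1 2 ^ 2 + p.1 3 ^ 2 := by
    rw [← h3, ← h4]; linear_combination -t ^ 2 * Real.sin_sq_add_cos_sq (hopfPhi2 p)
  have hr0 : 0 ≤ r := norm_nonneg _
  have hr1 : r ≤ 1 := by nlinarith [sq_nonneg t]
  have hc : Real.cos (hopfS p) = r := Real.cos_arccos (by linarith) hr1
  have hs : Real.sin (hopfS p) ^ 2 = t ^ 2 := by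
    have := Real.sin_sq_add_cos_sq (hopfS p)
    rw [hc] at this; linarith
  have hc4 : Real.cos (4 * hopfS p) = 1 - 8 * r ^ 2 * t ^ 2 := by
    rw [show 4 * hopfS p = 2 * (2 * hopfS p) by ring, Real.cos_two_mul, Real.cos_two_mul, hc]
    have : t ^ 2 = 1 - r ^ 2 := by linarith
    rw [this]; ring
  have hs2 : Real.sin (2 * hopfS p) ^ 2 = 4 * t ^ 2 * r ^ 2 := by
    rw [Real.sin_two_mul, hc, ← hs]; ring
  rw [psi, hc4, hs2, Real.cos_two_mul', Real.cos_sub, Real.sin_sub, ← hr2, ← ht2,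
    ← h1, ← h2, ← h3, ← h4]
  ring

/-- `u_a = F(ψ_a) ξ + φ(grad ψ_a)`. -/
def field (F : ℝ → ℝ) (a : ℝ) (p : S3) : E4 :=
  F (psi a p) • xi p + phi p (grad (psi a) p)

/-- `b = ½ F(ψ_a)² - 12 ψ_a² + 16 ψ_a - 2 ∫₀^{ψ_a} F(q) dq`. -/
def bernoulliFn (F : ℝ → ℝ) (a : ℝ) (p : S3) : ℝ :=
  1 / 2 * F (psi a p) ^ 2 - 12 * psi a p ^ 2 + 16 * psi a p -
    2 * ∫ q in (0 : ℝ)..psi a p, F q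

end

end SphereEuler

open SphereEuler

namespace SphereEuler

/-! On the sphere, `psi a` is the restriction of a quartic `g = ∑ mᵢ hᵢ²`, a diagonal quadratic form
in the components `hᵢ = ⟪x, σᵢ x⟫` of the Hopf map, with `∑ mᵢ = 2`. All the calculus can thus be
done in `ℝ⁴` with the Euclidean gradient `G`, the Hessian `H` and multiplication `J` by `i`,
followed by projection to `p^⊥`. The field becomes `u = (F(g) + 4g) Jx - JG`, and Hopf invariance of
`g` gives `⟪G, Jx⟫ = 0` and `H Jx = JG`.

Since `⟪G, u⟫ = 0`, the acceleration `D_u u` is a combination of `x`, `G` and `JHJG`. Every function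
of `g` times `G` is a gradient, and so is `HG = grad(|G|²/2)`. The Euler equation therefore reduces
to `HG - JHJG = 8(∑ mᵢ) G` modulo `x` on the sphere (`hopfQuadHess_sub_conj`). The reason is that `H
- JHJ` is symmetric and commutes with `J`, so its compression to the contact plane is a scalar, and
this scalar is affine in `g`.

The same algebra yields `u(|u|²) = 256 (m₀-m₁)(m₁-m₂)(m₂-m₀) h₀h₁h₂`, independently of `F`. For `a ≥
0` the coefficients coincide in pairs only when `a = 0` or `a = 1`. In these cases the form has an
axis of rotation: the third axis, giving a KKPS field, or the second, which a quarter turn moves to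
the third. Otherwise the derivative is nonzero somewhere. KKPS fields conserve their speed and
isometries preserve this property, so no such field is isometric to a KKPS field. -/

/-! ### Differentials on the sphere through ambient extensions. -/

theorem sphere_ne_zero (p : S3) : (p : E4) ≠ 0 := fun h => by
  simpa [h] using norm_eq_of_mem_sphere p

/-- The orthogonal projection onto `p^⊥`. -/
noncomputable def tangentProj (p : S3) : E4 →L[ℝ] E4 :=
  ContinuousLinearMap.id ℝ E4 - (innerSL ℝ (p : E4)).smulRight (p : E4)

theorem tangentProj_apply (p : S3) (w : E4) :
    tangentProj p w = w - inner ℝ (p : E4) w • (p : E4) := by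
  simp [tangentProj]

theorem inner_self_sphere (p : S3) : inner ℝ (p : E4) (p : E4) = 1 := by
  rw [real_inner_self_eq_norm_sq, norm_eq_of_mem_sphere p]; norm_num

theorem inner_tangentProj (p : S3) (w : E4) : inner ℝ (p : E4) (tangentProj p w) = 0 := by
  rw [tangentProj_apply, inner_sub_right, inner_smul_right, inner_self_sphere]; ring

theorem tangentProj_of_tangent {p : S3} {w : E4} (h : inner ℝ (p : E4) w = 0) :
    tangentProj p w = w := by
  simp [tangentProj_apply, h]

theorem hasFDerivAt_normalize (p : S3) :
    HasFDerivAt (fun x : E4 => ((toSphere x : S3) : E4)) (tangentProj p) (p : E4) := by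
  have h0 := sphere_ne_zero p
  have h1 : HasFDerivAt (fun x : E4 => ‖x‖ ^ 2) (2 • innerSL ℝ (p : E4)) (p : E4) :=
    (hasStrictFDerivAt_norm_sq (p : E4)).hasFDerivAt
  have h2 := h1.sqrt (by simp)
  have h3 : HasFDerivAt (fun x : E4 => ‖x‖) (innerSL ℝ (p : E4)) (p : E4) := by
    refine (h2.congr_fderiv ?_).congr_of_eventuallyEq (.of_forall fun x => ?_)
    · ext w; simp
    · exact (Real.sqrt_sq (norm_nonneg x)).symm
  have h4 := ((hasDerivAt_inv (x := ‖(p : E4)‖) (by simp)).comp_hasFDerivAt _ h3).smul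
    (hasFDerivAt_id (p : E4))
  have h5 : (fun x : E4 => ((toSphere x : S3) : E4)) =ᶠ[nhds (p : E4)]
      fun x => ‖x‖⁻¹ • x := by
    filter_upwards [isOpen_ne.mem_nhds h0] with x hx
    simp [toSphere, show x ≠ 0 from hx]
  refine (h4.congr_fderiv ?_).congr_of_eventuallyEq h5
  ext1 w
  simp [tangentProj_apply]
  abel

section Calculus

variable {V : Type*} [NormedAddCommGroup V] [NormedSpace ℝ V]

/-- The differential of the restriction to `S³` of a map defined near `p` in `ℝ⁴`. -/
theorem sphereD_restrict {f : S3 → V} {g : E4 → V} {g' : E4 →L[ℝ] V} {p : S3}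
    (hfg : ∀ q : S3, f q = g q) (hg : HasFDerivAt g g' p) (w : E4) :
    sphereD f p w = g' (tangentProj p w) := by
  have h1 : radial f = g ∘ fun x : E4 => ((toSphere x : S3) : E4) := by
    funext x; simp [radial, hfg]
  rw [← toSphere_coe p] at hg
  have h2 := hg.comp (p : E4) (hasFDerivAt_normalize p)
  rw [sphereD, h1, h2.fderiv]
  rfl

theorem differentiableAt_radial {f : S3 → V} (hf : ContMDiff (𝓡 3) 𝓘(ℝ, V) ∞ f) (p : S3) :
    DifferentiableAt ℝ (radial f) (p : E4) := by
  have h2 : ContMDiffAt 𝓘(ℝ, E4) 𝓘(ℝ, V) ∞ (f ∘ toSphere) (p : E4) :=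
    (hf _).comp (p : E4) (contMDiffAt_toSphere (sphere_ne_zero p))
  exact h2.contDiffAt.differentiableAt (by simp)

theorem contMDiff_restrict {f : S3 → V} {g : E4 → V} (hfg : ∀ q : S3, f q = g q)
    (hg : ContDiff ℝ ∞ g) : ContMDiff (𝓡 3) 𝓘(ℝ, V) ∞ f := by
  rw [show f = g ∘ fun q : S3 => (q : E4) from funext hfg]
  have : Fact (Module.finrank ℝ E4 = 3 + 1) := ⟨finrank_euclideanSpace_fin⟩
  exact hg.contMDiff.comp (contMDiff_coe_sphere (n := 3))

theorem sphereD_comp {f : S3 → V} (hf : ContMDiff (𝓡 3) 𝓘(ℝ, V) ∞ f)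
    {Φ : S3 → S3} (hΦ : ContMDiff (𝓡 3) (𝓡 3) ∞ Φ) (p : S3) (w : E4) :
    sphereD (fun q => f (Φ q)) p w =
      sphereD f (Φ p) (sphereD (fun q => (Φ q : E4)) p w) := by
  have : Fact (Module.finrank ℝ E4 = 3 + 1) := ⟨finrank_euclideanSpace_fin⟩
  have h1 : radial (fun q => f (Φ q)) = radial f ∘ radial (fun q => (Φ q : E4)) := by
    funext x; simp [radial, toSphere_coe]
  have h2 : DifferentiableAt ℝ (radial fun q => (Φ q : E4)) (p : E4) :=
    differentiableAt_radial ((contMDiff_coe_sphere (n := 3)).comp hΦ) p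
  have h3 : radial (fun q => (Φ q : E4)) (p : E4) = Φ p := by simp [radial, toSphere_coe]
  have h4 := differentiableAt_radial hf (Φ p)
  rw [sphereD, h1, fderiv_comp _ (h3.symm ▸ h4) h2, h3]
  rfl

/-- The degree zero extension is constant along rays, so the normal part of `w` does not contribute.
This makes gradients tangent. -/
theorem sphereD_tangentProj {f : S3 → V} (hf : ContMDiff (𝓡 3) 𝓘(ℝ, V) ∞ f) (p : S3) (w : E4) :
    sphereD f p (tangentProj p w) = sphereD f p w := by
  refine (sphereD_restrict (g := radial f) (fun q => ?_)
    (differentiableAt_radial hf p).hasFDerivAt w).symm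
  simp [radial, toSphere_coe]

theorem inner_grad (f : S3 → ℝ) (p : S3) (w : E4) : inner ℝ (grad f p) w = sphereD f p w := by
  simp [grad]

theorem sphereD_add {f g : S3 → V} (hf : ContMDiff (𝓡 3) 𝓘(ℝ, V) ∞ f)
    (hg : ContMDiff (𝓡 3) 𝓘(ℝ, V) ∞ g) (p : S3) :
    sphereD (fun q => f q + g q) p = sphereD f p + sphereD g p :=
  fderiv_add (differentiableAt_radial hf p) (differentiableAt_radial hg p)

theorem sphereD_norm_sq {u : S3 → E4} (hu : ContMDiff (𝓡 3) 𝓘(ℝ, E4) ∞ u) (p : S3) (w : E4) :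
    sphereD (fun q => ‖u q‖ ^ 2) p w = 2 * inner ℝ (u p) (sphereD u p w) := by
  have h := (differentiableAt_radial hu p).hasFDerivAt.norm_sq
  rw [show sphereD (fun q => ‖u q‖ ^ 2) p = _ from h.fderiv]
  simp [radial, toSphere_coe, sphereD]

theorem inner_nabla (u : S3 → E4) (p : S3) (w z : E4) :
    inner ℝ (nabla w u p) z = inner ℝ (sphereD u p w) (tangentProj p z) := by
  rw [nabla, tangentProj_apply, inner_sub_left, inner_sub_right, inner_smul_left,
    inner_smul_right, real_inner_comm (sphereD u p w) (p : E4)]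
  simp; ring

end Calculus

/-! ### The oriented frame and the Lamb identity. -/

/-- Inner product of `ℝ⁴` in coordinates. -/
theorem inner_E4 (v w : E4) :
    inner ℝ v w = v 0 * w 0 + v 1 * w 1 + v 2 * w 2 + v 3 * w 3 := by
  rw [PiLp.inner_apply, Fin.sum_univ_four]
  simp; ring

theorem eq_sum_frame {p : S3} {w : E4} (hw : inner ℝ (p : E4) w = 0) :
    w = ∑ i, inner ℝ (frame i p) w • frame i p := by
  have hp := sq_sum p
  rw [inner_E4] at hw
  obtain ⟨p, _⟩ := p
  simp only at hp hw
  ext j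
  fin_cases j <;> simp [Fin.sum_univ_three, frame, xi, X1, X2, inner_E4]
  · linear_combination (-w 0) * hp + p 0 * hw
  · linear_combination (-w 1) * hp + p 1 * hw
  · linear_combination (-w 2) * hp + p 2 * hw
  · linear_combination (-w 3) * hp + p 3 * hw

theorem cross_frame (p : S3) (a b : Fin 3 → ℝ) :
    cross p (∑ i, a i • frame i p) (∑ i, b i • frame i p) =
      ∑ i, (a (i + 1) * b (i + 2) - a (i + 2) * b (i + 1)) • frame i p := by
  have hp := sq_sum p
  have hp2 : (p.1 0 ^ 2 + p.1 1 ^ 2 + p.1 2 ^ 2 + p.1 3 ^ 2) ^ 2 = 1 := by rw [hp]; norm_num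
  have key : ∀ k, vol p (∑ i, a i • frame i p) (∑ i, b i • frame i p) (frame k p) =
      a (k + 1) * b (k + 2) - a (k + 2) * b (k + 1) := by
    intro k
    -- The frame vectors have length `|p|` as polynomials in `p`, so the determinant carries a
    -- factor `|p|⁴`; with it the identity holds in all of `ℝ⁴`.
    have : vol p (∑ i, a i • frame i p) (∑ i, b i • frame i p) (frame k p) =
      (a (k + 1) * b (k + 2) - a (k + 2) * b (k + 1)) *
        (p.1 0 ^ 2 + p.1 1 ^ 2 + p.1 2 ^ 2 + p.1 3 ^ 2) ^ 2 := by
      fin_cases k <;>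
        simp [vol, frame, xi, X1, X2, Matrix.det_succ_row_zero, Fin.sum_univ_succ, Fin.succAbove] <;>
        ring
    rw [this, hp2, mul_one]
  simp only [cross, key]

/-- The Lamb identity `u × curl u = grad (|u|²/2) - ∇_u u`, for Euler fields. -/
theorem cross_curl_eq_grad {u : S3 → E4} (hu : IsVectorField u) {π b : S3 → ℝ}
    (hπ : IsPressure u π) (hb : ∀ p, b p = π p + 1 / 2 * ‖u p‖ ^ 2) (p : S3) :
    cross p (u p) (curl u p) = grad b p := by
  have hsq : ContMDiff (𝓡 3) 𝓘(ℝ, ℝ) ∞ fun q => ‖u q‖ ^ 2 :=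
    (contDiff_norm_sq ℝ).contMDiff.comp hu.smooth
  -- The Euler equation gives `dπ(w) = -⟪D_u u, w⟫`, and half the derivative of `|u|²` is `⟪D_w u,
  -- u⟫`; the sum is `du♭(w, u)`.
  have hD : ∀ w, inner ℝ (p : E4) w = 0 → sphereD b p w = dFlat u p w (u p) := by
    intro w hw
    have h1 : b = fun q => π q + (1 / 2 : ℝ) • ‖u q‖ ^ 2 := funext hb
    have h2 : sphereD (fun q => (1 / 2 : ℝ) • ‖u q‖ ^ 2) p
        = (1 / 2 : ℝ) • sphereD (fun q => ‖u q‖ ^ 2) p :=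
      fderiv_const_smul (differentiableAt_radial hsq p) (1 / 2 : ℝ)
    have h3 := inner_grad π p w
    have h4 := inner_nabla u p (u p) w
    rw [hπ.euler, inner_neg_left, tangentProj_of_tangent hw, h3] at h4
    have h5 : sphereD b p = sphereD π p + sphereD (fun q => (1 / 2 : ℝ) • ‖u q‖ ^ 2) p := by
      rw [h1]
      exact sphereD_add hπ.smooth ((contDiff_const_smul _).contMDiff.comp hsq) p
    rw [h5, h2]
    simp only [add_apply, smul_apply, smul_eq_mul, dFlat]
    rw [sphereD_norm_sq hu.smooth, real_inner_comm (sphereD u p w) (u p)]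
    linarith
  have hbs : ContMDiff (𝓡 3) 𝓘(ℝ, ℝ) ∞ b := by
    rw [show b = fun q => π q + 1 / 2 * ‖u q‖ ^ 2 from funext hb]
    exact hπ.smooth.add (contMDiff_const.mul hsq)
  have hg : inner ℝ (p : E4) (grad b p) = 0 := by
    rw [real_inner_comm, inner_grad, ← sphereD_tangentProj hbs, tangentProj_apply,
      inner_self_sphere]
    simp
  have hflat : ∀ w, dFlat u p w (u p) = ∑ j, inner ℝ (frame j p) (u p) * dFlat u p w (frame j p) := by
    intro w
    conv_lhs => rw [eq_sum_frame (hu.tangent p)]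
    simp only [dFlat, map_sum, map_smul, sum_inner, inner_sum, inner_smul_left, inner_smul_right,
      mul_sub, Finset.sum_sub_distrib]
    simp
  have hskew : ∀ v w, dFlat u p v w = -dFlat u p w v := fun v w => by simp [dFlat]
  have hself : ∀ v, dFlat u p v v = 0 := fun v => by simp [dFlat]
  rw [eq_sum_frame hg]
  conv_lhs => rw [eq_sum_frame (hu.tangent p), curl, cross_frame]
  refine Finset.sum_congr rfl fun i _ => ?_
  congr 1
  rw [real_inner_comm (grad b p), inner_grad, hD _ ((frame_orthonormal p).2.1 i), hflat, Fin.sum_univ_three]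
  fin_cases i <;> simp [hself]
  · rw [hskew (frame 2 p) (frame 0 p)]; ring
  · rw [hskew (frame 1 p) (frame 0 p)]; ring
  · rw [hskew (frame 2 p) (frame 1 p)]; ring

/-! ### Quadratic forms in the Hopf map: gradient, Hessian and their identities. -/

/-- Multiplication by `i` on `ℝ⁴ = ℂ²`. -/
noncomputable def cplxJ : E4 →L[ℝ] E4 :=
  LinearMap.toContinuousLinearMap
    { toFun := fun x => !₂[-x 1, x 0, -x 3, x 2]
      map_add' := fun x y => by ext j; fin_cases j <;> simp <;> ring
      map_smul' := fun c x => by ext j; fin_cases j <;> simp }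

/-- The Pauli matrices, as real symmetric maps of `ℝ⁴ = ℂ²`. -/
noncomputable def pauli (i : Fin 3) : E4 →L[ℝ] E4 :=
  LinearMap.toContinuousLinearMap
    { toFun := fun x => ![!₂[x 2, x 3, x 0, x 1], !₂[-x 3, x 2, x 1, -x 0],
        !₂[x 0, x 1, -x 2, -x 3]] i
      map_add' := fun x y => by ext j; fin_cases i <;> fin_cases j <;> simp <;> ring
      map_smul' := fun c x => by ext j; fin_cases i <;> fin_cases j <;> simp }

theorem cplxJ_apply (x : E4) : cplxJ x = !₂[-x 1, x 0, -x 3, x 2] := rfl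

theorem pauli_apply (i : Fin 3) (x : E4) : pauli i x =
    ![!₂[x 2, x 3, x 0, x 1], !₂[-x 3, x 2, x 1, -x 0], !₂[x 0, x 1, -x 2, -x 3]] i := rfl

/-- The components of the Hopf map `ℝ⁴ → ℝ³`. -/
noncomputable def hopf (i : Fin 3) (x : E4) : ℝ := inner ℝ x (pauli i x)

/-- A diagonal quadratic form in the components of the Hopf map. -/
noncomputable def hopfQuad (m : Fin 3 → ℝ) (x : E4) : ℝ := ∑ i, m i * hopf i x ^ 2

/-- The Euclidean gradient of `hopfQuad m`. -/
noncomputable def hopfQuadGrad (m : Fin 3 → ℝ) (x : E4) : E4 :=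
  ∑ i, (4 * m i * hopf i x) • pauli i x

/-- The Euclidean Hessian of `hopfQuad m`. -/
noncomputable def hopfQuadHess (m : Fin 3 → ℝ) (x : E4) : E4 →L[ℝ] E4 :=
  ∑ i, ((4 * m i * hopf i x) • pauli i +
    ((4 * m i) • (2 : ℝ) • innerSL ℝ (pauli i x)).smulRight (pauli i x))

theorem inner_pauli (i : Fin 3) (x y : E4) : inner ℝ (pauli i x) y = inner ℝ x (pauli i y) := by
  fin_cases i <;> simp [inner_E4, pauli_apply] <;> ring

theorem hasFDerivAt_hopf (i : Fin 3) (x : E4) :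
    HasFDerivAt (hopf i) ((2 : ℝ) • innerSL ℝ (pauli i x)) x := by
  refine ((hasFDerivAt_id x).inner ℝ (pauli i).hasFDerivAt).congr_fderiv ?_
  ext w
  simp [← inner_pauli]
  rw [inner_pauli i w x, real_inner_comm (pauli i x) w]
  ring

theorem hasFDerivAt_hopfQuad (m : Fin 3 → ℝ) (x : E4) :
    HasFDerivAt (hopfQuad m) (innerSL ℝ (hopfQuadGrad m x)) x := by
  refine (HasFDerivAt.fun_sum (u := Finset.univ) fun i _ =>
    ((hasFDerivAt_hopf i x).pow 2).const_mul (m i)).congr_fderiv ?_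
  ext w
  simp [hopfQuadGrad, Fin.sum_univ_three]
  ring

theorem hasFDerivAt_hopfQuadGrad (m : Fin 3 → ℝ) (x : E4) :
    HasFDerivAt (hopfQuadGrad m) (hopfQuadHess m x) x := by
  refine (HasFDerivAt.fun_sum (u := Finset.univ) fun i _ =>
    ((hasFDerivAt_hopf i x).const_mul (4 * m i)).smul (pauli i).hasFDerivAt)

theorem contDiff_hopf (i : Fin 3) : ContDiff ℝ ∞ (hopf i) :=
  contDiff_id.inner ℝ (pauli i).contDiff

theorem contDiff_hopfQuad (m : Fin 3 → ℝ) : ContDiff ℝ ∞ (hopfQuad m) :=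
  ContDiff.sum fun i _ => contDiff_const.mul ((contDiff_hopf i).pow 2)

theorem contDiff_hopfQuadGrad (m : Fin 3 → ℝ) : ContDiff ℝ ∞ (hopfQuadGrad m) :=
  ContDiff.sum fun i _ => (contDiff_const.mul (contDiff_hopf i)).smul (pauli i).contDiff

section Algebra

variable (m : Fin 3 → ℝ) (x y : E4)

theorem norm_sq_E4 : ‖x‖ ^ 2 = x 0 ^ 2 + x 1 ^ 2 + x 2 ^ 2 + x 3 ^ 2 := by
  rw [← real_inner_self_eq_norm_sq, inner_E4]; ring

theorem hopf_zero : hopf 0 x = 2 * (x 0 * x 2 + x 1 * x 3) := by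
  simp [hopf, inner_E4, pauli_apply]; ring

theorem hopf_one : hopf 1 x = 2 * (x 1 * x 2 - x 0 * x 3) := by
  simp [hopf, inner_E4, pauli_apply]; ring

theorem hopf_two : hopf 2 x = x 0 ^ 2 + x 1 ^ 2 - x 2 ^ 2 - x 3 ^ 2 := by
  simp [hopf, inner_E4, pauli_apply]; ring

theorem inner_cplxJ_left : inner ℝ (cplxJ x) y = -inner ℝ x (cplxJ y) := by
  simp [inner_E4, cplxJ_apply]; ring

theorem inner_cplxJ_self : inner ℝ x (cplxJ x) = 0 := by
  simp [inner_E4, cplxJ_apply]; ring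

theorem cplxJ_cplxJ : cplxJ (cplxJ x) = -x := by
  ext j; fin_cases j <;> simp [cplxJ_apply]

theorem cplxJ_pauli (i : Fin 3) : cplxJ (pauli i x) = pauli i (cplxJ x) := by
  ext j; fin_cases i <;> fin_cases j <;> simp [cplxJ_apply, pauli_apply]

theorem inner_pauli_cplxJ_self (i : Fin 3) : inner ℝ (pauli i x) (cplxJ x) = 0 := by
  have h := inner_pauli i x (cplxJ x)
  have h2 := inner_cplxJ_left x (pauli i x)
  rw [← cplxJ_pauli] at h
  rw [real_inner_comm] at h2
  linarith

theorem hopfQuadHess_apply : hopfQuadHess m x y = ∑ i, ((4 * m i * hopf i x) • pauli i y +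
    (8 * m i * inner ℝ (pauli i x) y) • pauli i x) := by
  simp only [hopfQuadHess, sum_apply, add_apply, smul_apply, ContinuousLinearMap.smulRight_apply,
    innerSL_apply_apply, smul_eq_mul]
  refine Finset.sum_congr rfl fun i _ => ?_
  congr 2
  ring

/-- Euler's relation for a quartic. -/
theorem inner_hopfQuadGrad_self : inner ℝ x (hopfQuadGrad m x) = 4 * hopfQuad m x := by
  simp only [hopfQuadGrad, hopfQuad, inner_sum, inner_smul_right, Finset.mul_sum]
  refine Finset.sum_congr rfl fun i _ => ?_
  rw [← hopf]; ring

theorem inner_hopfQuadGrad_cplxJ : inner ℝ (hopfQuadGrad m x) (cplxJ x) = 0 := by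
  simp [hopfQuadGrad, sum_inner, inner_smul_left, inner_pauli_cplxJ_self]

/-- Infinitesimal form of the equivariance of the gradient under the Hopf flow `e^{tJ}`, which
preserves the quartic. -/
theorem hopfQuadHess_cplxJ : hopfQuadHess m x (cplxJ x) = cplxJ (hopfQuadGrad m x) := by
  simp [hopfQuadHess_apply, hopfQuadGrad, inner_pauli_cplxJ_self, cplxJ_pauli]

theorem inner_hopfQuadHess (w : E4) :
    inner ℝ (hopfQuadHess m x y) w = inner ℝ y (hopfQuadHess m x w) := by
  simp only [hopfQuadHess_apply, sum_inner, inner_sum, inner_add_left, inner_add_right,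
    inner_smul_left, inner_smul_right]
  refine Finset.sum_congr rfl fun i _ => ?_
  rw [inner_pauli, real_inner_comm (pauli i x) y]
  simp; ring

theorem hopfQuadHess_self : hopfQuadHess m x x = (3 : ℝ) • hopfQuadGrad m x := by
  simp only [hopfQuadHess_apply, hopfQuadGrad, Finset.smul_sum, smul_smul, ← add_smul]
  refine Finset.sum_congr rfl fun i _ => ?_
  rw [real_inner_comm, ← hopf]; congr 1; ring

/-- This is what makes the fields steady: `H - JHJ` sends `G` to a constant multiple of `G`, up to
the normal direction, when `|x| = 1`. It is a polynomial identity, checked by coordinates. -/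
theorem hopfQuadHess_sub_conj :
    hopfQuadHess m x (hopfQuadGrad m x) - cplxJ (hopfQuadHess m x (cplxJ (hopfQuadGrad m x))) =
      (8 * (∑ i, m i) * ‖x‖ ^ 2) • hopfQuadGrad m x +
        (64 * ∑ i, m i ^ 2 * hopf i x ^ 2 - 32 * (∑ i, m i) * hopfQuad m x) • x := by
  rw [norm_sq_E4]
  ext j
  fin_cases j <;>
    simp [hopfQuadHess_apply, hopfQuadGrad, hopfQuad, Fin.sum_univ_three, hopf_zero, hopf_one,
      hopf_two, inner_E4, pauli_apply, cplxJ_apply] <;> ring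

/-- The derivative of `|G|²/2` along `JG`. As `|G|² = 16 |x|² ∑ mᵢ² hᵢ²`, it is a Jacobian of `∑
hᵢ²`, `∑ mᵢ hᵢ²` and `∑ mᵢ² hᵢ²`, whence the Vandermonde factor. -/
theorem inner_cplxJ_grad_hess :
    inner ℝ (cplxJ (hopfQuadGrad m x)) (hopfQuadHess m x (hopfQuadGrad m x)) =
      -128 * (m 0 - m 1) * (m 1 - m 2) * (m 2 - m 0) *
        (hopf 0 x * hopf 1 x * hopf 2 x) * ‖x‖ ^ 2 := by
  rw [norm_sq_E4]
  simp [hopfQuadHess_apply, hopfQuadGrad, Fin.sum_univ_three, hopf_zero, hopf_one,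
      hopf_two, inner_E4, pauli_apply, cplxJ_apply]
  ring

end Algebra

/-! ### The fields as restrictions from `ℝ⁴`, their pressure, divergence and curl. -/

/-- Extension to `ℝ⁴` of the field `F(ψ) ξ + φ(grad ψ)`, `ψ = hopfQuad m`. -/
noncomputable def hopfField (F : ℝ → ℝ) (m : Fin 3 → ℝ) (x : E4) : E4 :=
  (F (hopfQuad m x) + 4 * hopfQuad m x) • cplxJ x - cplxJ (hopfQuadGrad m x)

/-- A pressure of `hopfField F m`. -/
noncomputable def hopfPressure (F : ℝ → ℝ) (m : Fin 3 → ℝ) (x : E4) : ℝ :=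
  -2 * (∫ q in (0 : ℝ)..hopfQuad m x, F q) - 4 * hopfQuad m x ^ 2 +
    8 * (∑ i, m i) * hopfQuad m x - 1 / 2 * ‖hopfQuadGrad m x‖ ^ 2

theorem tangentProj_tangentProj (p : S3) (w : E4) :
    tangentProj p (tangentProj p w) = tangentProj p w :=
  tangentProj_of_tangent (inner_tangentProj p w)

theorem inner_tangentProj_comm (p : S3) (v w : E4) :
    inner ℝ (tangentProj p v) w = inner ℝ v (tangentProj p w) := by
  simp only [tangentProj_apply, inner_sub_left, inner_sub_right, inner_smul_left,
    inner_smul_right, real_inner_comm v (p : E4)]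
  simp; ring

theorem nabla_eq (w : E4) (u : S3 → E4) (p : S3) :
    nabla w u p = tangentProj p (sphereD u p w) := by
  rw [nabla, tangentProj_apply]

theorem xi_eq (p : S3) : xi p = cplxJ p := rfl

theorem phi_eq (p : S3) (w : E4) : phi p w = -tangentProj p (cplxJ (tangentProj p w)) := by
  rw [phi, nabla_eq, sphereD_restrict xi_eq cplxJ.hasFDerivAt]

theorem grad_eq {f : S3 → ℝ} {g : E4 → ℝ} {v : E4} {p : S3} (hfg : ∀ q : S3, f q = g q)
    (hg : HasFDerivAt g (innerSL ℝ v) (p : E4)) : grad f p = tangentProj p v := by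
  refine ext_inner_right ℝ fun w => ?_
  rw [inner_grad, sphereD_restrict hfg hg, inner_tangentProj_comm]
  rfl

theorem cplxJ_tangent (p : S3) : inner ℝ (p : E4) (cplxJ p) = 0 := inner_cplxJ_self _

theorem cplxJ_grad_tangent (m : Fin 3 → ℝ) (x : E4) :
    inner ℝ x (cplxJ (hopfQuadGrad m x)) = 0 := by
  have := inner_cplxJ_left x (hopfQuadGrad m x)
  rw [real_inner_comm, inner_hopfQuadGrad_cplxJ] at this
  linarith

/-- `hopfField F m` is `F(ψ) ξ + φ(grad ψ)` on the sphere. -/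
theorem hopfField_eq (F : ℝ → ℝ) (m : Fin 3 → ℝ) {ψ : S3 → ℝ} (hψ : ∀ q : S3, ψ q = hopfQuad m q)
    (p : S3) : F (ψ p) • xi p + phi p (grad ψ p) = hopfField F m p := by
  -- The tangential gradient is `G - 4g x`, and `φ` acts on it as `-J` followed by projection; this
  -- is the source of the term `4g Jx`.
  rw [grad_eq hψ (hasFDerivAt_hopfQuad m p), phi_eq, tangentProj_tangentProj,
    tangentProj_apply p (hopfQuadGrad m p),
    inner_hopfQuadGrad_self, map_sub, map_sub, map_smul, map_smul,
    tangentProj_of_tangent (cplxJ_tangent p), tangentProj_of_tangent (cplxJ_grad_tangent m p),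
    hψ, xi_eq, hopfField, add_smul]
  abel

/-- The coefficients of `ψ_a` as a quadratic form in the Hopf map. -/
noncomputable def psiCoeff (a : ℝ) : Fin 3 → ℝ := ![(1 + a) / 2, (1 - a) / 2, 1]

/-- With `h₀² + h₁² = 4|z₁|²|z₂|²` and `h₂² = |x|⁴ - 4|z₁|²|z₂|²`, the two sides differ by a
multiple of `|x|⁴ - 1`. -/
theorem psi_eq_hopfQuad (a : ℝ) (p : S3) : psi a p = hopfQuad (psiCoeff a) p := by
  have hp := sq_sum p
  rw [psi_eq]
  simp [hopfQuad, psiCoeff, Fin.sum_univ_three, hopf_zero, hopf_one, hopf_two]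
  linear_combination (-1 - (p.1 0 ^ 2 + p.1 1 ^ 2 + p.1 2 ^ 2 + p.1 3 ^ 2)) * hp

theorem field_eq (F : ℝ → ℝ) (a : ℝ) (p : S3) : field F a p = hopfField F (psiCoeff a) p :=
  hopfField_eq F _ (psi_eq_hopfQuad a) p

/-- The derivative of `hopfField F m`. -/
noncomputable def hopfFieldDeriv (F : ℝ → ℝ) (m : Fin 3 → ℝ) (x : E4) : E4 →L[ℝ] E4 :=
  (F (hopfQuad m x) + 4 * hopfQuad m x) • cplxJ +
    ((deriv F (hopfQuad m x) + 4) • innerSL ℝ (hopfQuadGrad m x)).smulRight (cplxJ x) -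
      cplxJ.comp (hopfQuadHess m x)

theorem hopfFieldDeriv_apply (F : ℝ → ℝ) (m : Fin 3 → ℝ) (x w : E4) :
    hopfFieldDeriv F m x w = (F (hopfQuad m x) + 4 * hopfQuad m x) • cplxJ w +
      ((deriv F (hopfQuad m x) + 4) * inner ℝ (hopfQuadGrad m x) w) • cplxJ x -
        cplxJ (hopfQuadHess m x w) := rfl

section Field

variable {F : ℝ → ℝ} (hF : ContDiff ℝ ∞ F) (m : Fin 3 → ℝ)
include hF

theorem hasFDerivAt_hopfField (x : E4) :
    HasFDerivAt (hopfField F m) (hopfFieldDeriv F m x) x := by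
  have hG := hasFDerivAt_hopfQuad m x
  have hFG := ((hF.differentiable (by simp)).differentiableAt
    (x := hopfQuad m x)).hasDerivAt.comp_hasFDerivAt x hG
  have hL := hFG.add (hG.const_mul 4)
  refine ((hL.smul cplxJ.hasFDerivAt).sub
    (cplxJ.hasFDerivAt.comp x (hasFDerivAt_hopfQuadGrad m x))).congr_fderiv ?_
  ext1 w
  simp [hopfFieldDeriv]
  congr 1
  ring

theorem contDiff_hopfField : ContDiff ℝ ∞ (hopfField F m) :=
  (((hF.comp (contDiff_hopfQuad m)).add (contDiff_const.mul (contDiff_hopfQuad m))).smul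
    cplxJ.contDiff).sub (cplxJ.contDiff.comp (contDiff_hopfQuadGrad m))

omit hF in
theorem inner_hopfField_self (p : E4) : inner ℝ p (hopfField F m p) = 0 := by
  rw [hopfField, inner_sub_right, inner_smul_right, inner_cplxJ_self, cplxJ_grad_tangent]
  ring

theorem isVectorField_hopfField : IsVectorField (fun p : S3 => hopfField F m p) :=
  ⟨fun p => inner_hopfField_self m p, contMDiff_restrict (fun _ => rfl) (contDiff_hopfField hF m)⟩

theorem sphereD_hopfField {p : S3} {w : E4} (hw : inner ℝ (p : E4) w = 0) :
    sphereD (fun p : S3 => hopfField F m p) p w = hopfFieldDeriv F m p w := by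
  rw [sphereD_restrict (fun _ => rfl) (hasFDerivAt_hopfField hF m p), tangentProj_of_tangent hw]

omit hF in
theorem inner_grad_hopfField (x : E4) :
    inner ℝ (hopfQuadGrad m x) (hopfField F m x) = 0 := by
  rw [hopfField, inner_sub_right, inner_smul_right, inner_hopfQuadGrad_cplxJ, inner_cplxJ_self]
  ring

omit hF in
/-- The acceleration `D_u u` in `ℝ⁴`. -/
theorem hopfFieldDeriv_self (x : E4) :
    hopfFieldDeriv F m x (hopfField F m x) =
      -(F (hopfQuad m x) + 4 * hopfQuad m x) ^ 2 • x +
        (2 * (F (hopfQuad m x) + 4 * hopfQuad m x)) • hopfQuadGrad m x +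
          cplxJ (hopfQuadHess m x (cplxJ (hopfQuadGrad m x))) := by
  rw [hopfFieldDeriv_apply, inner_grad_hopfField, hopfField]
  simp only [map_sub, map_smul, cplxJ_cplxJ, hopfQuadHess_cplxJ]
  module

omit hF in
theorem norm_sq_hopfField (x : E4) : ‖hopfField F m x‖ ^ 2 =
    (F (hopfQuad m x) + 4 * hopfQuad m x) ^ 2 * ‖x‖ ^ 2 -
      8 * (F (hopfQuad m x) + 4 * hopfQuad m x) * hopfQuad m x + ‖hopfQuadGrad m x‖ ^ 2 := by
  have hJ : ∀ y z, inner ℝ (cplxJ y) (cplxJ z) = inner ℝ y z := fun y z => by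
    rw [inner_cplxJ_left, cplxJ_cplxJ, inner_neg_right, neg_neg]
  simp only [← real_inner_self_eq_norm_sq, hopfField, inner_sub_left, inner_sub_right,
    inner_smul_left, inner_smul_right, hJ, real_inner_comm x (hopfQuadGrad m x),
    inner_hopfQuadGrad_self]
  simp
  ring

theorem hasFDerivAt_hopfPressure (x : E4) :
    HasFDerivAt (hopfPressure F m) (innerSL ℝ
      ((-2 * F (hopfQuad m x) - 8 * hopfQuad m x + 8 * ∑ i, m i) • hopfQuadGrad m x -
        hopfQuadHess m x (hopfQuadGrad m x))) x := by
  have hG := hasFDerivAt_hopfQuad m x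
  have h1 := (hF.continuous.integral_hasStrictDerivAt 0
    (hopfQuad m x)).hasDerivAt.comp_hasFDerivAt x hG
  refine ((((h1.const_mul (-2)).sub ((hG.pow 2).const_mul 4)).add
    (hG.const_mul (8 * ∑ i, m i))).sub
      ((hasFDerivAt_hopfQuadGrad m x).norm_sq.const_mul (1 / 2))).congr_fderiv ?_
  ext1 w
  simp [inner_hopfQuadHess]
  ring

theorem contDiff_hopfPressure : ContDiff ℝ ∞ (hopfPressure F m) := by
  have h : ContDiff ℝ ∞ fun t : ℝ => ∫ q in (0 : ℝ)..t, F q := by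
    rw [contDiff_infty_iff_deriv]
    have h (t : ℝ) := (hF.continuous.integral_hasStrictDerivAt 0 t).hasDerivAt
    exact ⟨fun t => (h t).differentiableAt, by rwa [funext fun t => (h t).deriv]⟩
  have hG := contDiff_hopfQuad m
  exact (((contDiff_const.mul (h.comp hG)).sub (contDiff_const.mul (hG.pow 2))).add
    (contDiff_const.mul hG)).sub (contDiff_const.mul ((contDiff_hopfQuadGrad m).norm_sq ℝ))

theorem isPressure_hopfPressure :
    IsPressure (fun p : S3 => hopfField F m p) (fun p : S3 => hopfPressure F m p) := by
  refine ⟨contMDiff_restrict (fun _ => rfl) (contDiff_hopfPressure hF m), fun p => ?_⟩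
  have hp : ‖(p : E4)‖ = 1 := norm_eq_of_mem_sphere p
  rw [grad_eq (fun _ => rfl) (hasFDerivAt_hopfPressure hF m p), nabla_eq,
    sphereD_hopfField hF m (inner_hopfField_self m _), hopfFieldDeriv_self, ← map_neg]
  have h := hopfQuadHess_sub_conj m (p : E4)
  rw [hp] at h
  have hpp : tangentProj p (p : E4) = 0 := by rw [tangentProj_apply, inner_self_sphere]; simp
  rw [← sub_eq_zero, ← map_sub]
  have h2 : ∀ c : ℝ, tangentProj p (c • (p : E4)) = 0 := fun c => by rw [map_smul, hpp, smul_zero]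
  -- The coefficient of `x` left over from `D_u u` and from `hopfQuadHess_sub_conj`; everything else
  -- cancels.
  refine Eq.trans ?_ (h2 (-(F (hopfQuad m p) + 4 * hopfQuad m p) ^ 2 -
    (64 * ∑ i, m i ^ 2 * hopf i (p : E4) ^ 2 - 32 * (∑ i, m i) * hopfQuad m p)))
  congr 1
  rw [sub_eq_iff_eq_add] at h
  rw [h]
  module

theorem divergence_hopfField (p : S3) : divergence (fun p : S3 => hopfField F m p) p = 0 := by
  -- On the contact plane `X₂ = J X₁`, so a skew map composed with a symmetric one has zero trace.
  have htr : inner ℝ (cplxJ (hopfQuadHess m p (X1 p))) (X1 p) +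
      inner ℝ (cplxJ (hopfQuadHess m p (X2 p))) (X2 p) = 0 := by
    have h : X2 p = cplxJ (X1 p) := by ext j; fin_cases j <;> simp [X1, X2, cplxJ_apply]
    have h' : cplxJ (X2 p) = -X1 p := by rw [h, cplxJ_cplxJ]
    rw [inner_cplxJ_left, ← h, inner_cplxJ_left, h', inner_hopfQuadHess,
      real_inner_comm (hopfQuadHess m p (X2 p)), inner_neg_right]
    ring
  have hD : ∀ i, inner ℝ (nabla (frame i p) (fun p : S3 => hopfField F m p) p) (frame i p) =
      (deriv F (hopfQuad m p) + 4) * inner ℝ (hopfQuadGrad m p) (frame i p) *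
        inner ℝ (frame 0 p) (frame i p) -
      inner ℝ (cplxJ (hopfQuadHess m p (frame i p))) (frame i p) := by
    intro i
    have hi := (frame_orthonormal p).2.1 i
    rw [inner_nabla, tangentProj_of_tangent hi, sphereD_hopfField hF m hi, hopfFieldDeriv_apply,
      inner_sub_left, inner_add_left, inner_smul_left, inner_smul_left,
      real_inner_comm (frame i p) (cplxJ (frame i p)), inner_cplxJ_self]
    simp [frame, xi_eq]
  have ho := orthonormal_iff_ite.1 (frame_orthonormal p).1
  simp only [divergence, hD, Fin.sum_univ_three, ho]
  simp [frame]
  rw [xi_eq, inner_hopfQuadGrad_cplxJ, hopfQuadHess_cplxJ, cplxJ_cplxJ, inner_neg_left,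
    inner_hopfQuadGrad_cplxJ]
  linarith

theorem isSteadyEuler_hopfField : IsSteadyEuler (fun p : S3 => hopfField F m p) :=
  ⟨isVectorField_hopfField hF m, ⟨_, isPressure_hopfPressure hF m⟩, divergence_hopfField hF m⟩

/-- The derivative of `|u|²` along `u = hopfField F m`. -/
theorem sphereD_norm_sq_hopfField (p : S3) :
    sphereD (fun q : S3 => ‖hopfField F m q‖ ^ 2) p (hopfField F m p) =
      256 * (m 0 - m 1) * (m 1 - m 2) * (m 2 - m 0) *
        (hopf 0 (p : E4) * hopf 1 (p : E4) * hopf 2 (p : E4)) := by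
  have hk := inner_cplxJ_grad_hess m (p : E4)
  rw [norm_eq_of_mem_sphere p] at hk
  rw [sphereD_norm_sq (isVectorField_hopfField hF m).smooth,
    sphereD_hopfField hF m (inner_hopfField_self m _), hopfFieldDeriv_self, inner_add_right,
    inner_add_right, inner_smul_right, inner_smul_right, real_inner_comm (p : E4),
    inner_hopfField_self, real_inner_comm (hopfQuadGrad m p), inner_grad_hopfField,
    hopfField, inner_sub_left, inner_smul_left, inner_cplxJ_left, cplxJ_cplxJ, inner_neg_right,
    inner_cplxJ_left, cplxJ_cplxJ, inner_neg_right, ← inner_hopfQuadHess,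
    ← inner_hopfQuadHess, hopfQuadHess_self, inner_smul_left, inner_cplxJ_self,
    real_inner_comm (cplxJ (hopfQuadGrad m p)), hk]
  ring

/-- For `F(x) = 6 x - 4` and coefficients of sum `2`, the field is a curl eigenfield. -/
theorem curl_hopfField (hm : ∑ i, m i = 2) (hF' : ∀ x, F x = 2 * (3 * x - 2)) (p : S3) :
    curl (fun p : S3 => hopfField F m p) p = (6 : ℝ) • hopfField F m p := by
  -- The transverse trace of the Hessian enters only the `ξ` component of the curl, and there `∑ mᵢ
  -- = 2` matches the constant term of `F`.
  have htr : inner ℝ (hopfQuadHess m p (X1 p)) (X1 p) +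
      inner ℝ (hopfQuadHess m p (X2 p)) (X2 p) = 8 * (∑ i, m i) - 16 * hopfQuad m p := by
    have hp := sq_sum p
    have : inner ℝ (hopfQuadHess m p (X1 p)) (X1 p) +
      inner ℝ (hopfQuadHess m p (X2 p)) (X2 p) = 8 * (∑ i, m i) *
        (p.1 0 ^ 2 + p.1 1 ^ 2 + p.1 2 ^ 2 + p.1 3 ^ 2) ^ 2 - 16 * hopfQuad m p := by
      simp [hopfQuadHess_apply, hopfQuad, Fin.sum_univ_three, hopf_zero, hopf_one,
        hopf_two, inner_E4, pauli_apply, X1, X2]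
      ring
    rw [this, hp]; ring
  have hd : ∀ x, deriv F x = 6 := fun x => by
    rw [show F = fun x => 2 * (3 * x - 2) from funext hF']
    exact ((((hasDerivAt_id x).const_mul 3).sub_const 2).const_mul 2).deriv.trans (by norm_num)
  have hX : X2 p = cplxJ (X1 p) := by ext j; fin_cases j <;> simp [X1, X2, cplxJ_apply]
  have hX' : cplxJ (X2 p) = -X1 p := by rw [hX, cplxJ_cplxJ]
  have hxi : cplxJ (xi p) = -p := by rw [xi_eq, cplxJ_cplxJ]
  have ho := orthonormal_iff_ite.1 (frame_orthonormal p).1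
  have ht := (frame_orthonormal p).2.1
  -- Here `F(g) + 4g = 10g - 4` and `F' + 4 = 10`; the factor 2 appears because `J` is skew.
  have hfl : ∀ v w, inner ℝ (p : E4) v = 0 → inner ℝ (p : E4) w = 0 →
      dFlat (fun p : S3 => hopfField F m p) p v w =
        2 * (10 * hopfQuad m p - 4) * inner ℝ (cplxJ v) w +
        10 * (inner ℝ (hopfQuadGrad m p) v * inner ℝ (xi p) w -
          inner ℝ (hopfQuadGrad m p) w * inner ℝ (xi p) v) +
        inner ℝ (hopfQuadHess m p v) (cplxJ w) - inner ℝ (hopfQuadHess m p w) (cplxJ v) := by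
    intro v w hv hw
    have h1 : inner ℝ (cplxJ w) v = -inner ℝ (cplxJ v) w := by
      rw [inner_cplxJ_left, real_inner_comm]
    rw [dFlat, sphereD_hopfField hF m hv, sphereD_hopfField hF m hw]
    simp only [hopfFieldDeriv_apply, inner_sub_left, inner_add_left, inner_smul_left,
      inner_cplxJ_left (hopfQuadHess m p _), hd, hF', xi_eq, h1]
    simp
    ring
  rw [curl, eq_sum_frame (w := (6 : ℝ) • hopfField F m p)
    (by rw [inner_smul_right, inner_hopfField_self, mul_zero])]
  refine Finset.sum_congr rfl fun i _ => ?_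
  congr 1
  have hJ1 : inner ℝ (X1 p) (cplxJ (hopfQuadGrad m p)) = -inner ℝ (hopfQuadGrad m p) (X2 p) := by
    rw [hX, real_inner_comm, inner_cplxJ_left]
  have hJ2 : inner ℝ (X2 p) (cplxJ (hopfQuadGrad m p)) = inner ℝ (hopfQuadGrad m p) (X1 p) := by
    rw [real_inner_comm, inner_cplxJ_left, hX', inner_neg_right, neg_neg]
  have hJ0 : inner ℝ (xi p) (cplxJ (hopfQuadGrad m p)) = 4 * hopfQuad m p := by
    rw [real_inner_comm, inner_cplxJ_left, hxi, inner_neg_right, neg_neg, real_inner_comm,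
      inner_hopfQuadGrad_self]
  have hH (w : E4) : inner ℝ (hopfQuadHess m p w) (p : E4) = 3 * inner ℝ (hopfQuadGrad m p) w := by
    rw [inner_hopfQuadHess, hopfQuadHess_self, inner_smul_right, real_inner_comm]
  have hHx (w : E4) : inner ℝ (hopfQuadHess m p (xi p)) w =
      -inner ℝ (hopfQuadGrad m p) (cplxJ w) := by
    rw [xi_eq, hopfQuadHess_cplxJ, inner_cplxJ_left]
  have hg0 : inner ℝ (hopfQuadGrad m p) (xi p) = 0 := inner_hopfQuadGrad_cplxJ m p
  have h00 : inner ℝ (xi p) (xi p) = 1 := ho 0 0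
  have h01 : inner ℝ (xi p) (X1 p) = 0 := ho 0 1
  have h02 : inner ℝ (xi p) (X2 p) = 0 := ho 0 2
  have h10 : inner ℝ (X1 p) (xi p) = 0 := ho 1 0
  have h20 : inner ℝ (X2 p) (xi p) = 0 := ho 2 0
  have h22 : inner ℝ (X2 p) (X2 p) = 1 := ho 2 2
  have hp1 : inner ℝ (p : E4) (X1 p) = 0 := ht 1
  rw [hfl _ _ (ht _) (ht _), hopfField, inner_smul_right, inner_sub_right, inner_smul_right, hF',
    ← xi_eq]
  fin_cases i
  · change 2 * (10 * hopfQuad m p - 4) * inner ℝ (cplxJ (X1 p)) (X2 p) +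
      10 * (inner ℝ (hopfQuadGrad m p) (X1 p) * inner ℝ (xi p) (X2 p) -
        inner ℝ (hopfQuadGrad m p) (X2 p) * inner ℝ (xi p) (X1 p)) +
      inner ℝ (hopfQuadHess m p (X1 p)) (cplxJ (X2 p)) -
      inner ℝ (hopfQuadHess m p (X2 p)) (cplxJ (X1 p)) =
      6 * (_ * inner ℝ (xi p) (xi p) - inner ℝ (xi p) (cplxJ (hopfQuadGrad m p)))
    rw [hX', ← hX, h22, h00, h01, h02, hJ0, inner_neg_right]
    linear_combination -htr - 8 * hm
  · change 2 * (10 * hopfQuad m p - 4) * inner ℝ (cplxJ (X2 p)) (xi p) +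
      10 * (inner ℝ (hopfQuadGrad m p) (X2 p) * inner ℝ (xi p) (xi p) -
        inner ℝ (hopfQuadGrad m p) (xi p) * inner ℝ (xi p) (X2 p)) +
      inner ℝ (hopfQuadHess m p (X2 p)) (cplxJ (xi p)) -
      inner ℝ (hopfQuadHess m p (xi p)) (cplxJ (X2 p)) =
      6 * (_ * inner ℝ (X1 p) (xi p) - inner ℝ (X1 p) (cplxJ (hopfQuadGrad m p)))
    rw [hHx, hX', map_neg, ← hX, hxi, inner_neg_left, inner_neg_right, inner_neg_right, hH, h00,
      h10, h02, hJ1]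
    ring
  · change 2 * (10 * hopfQuad m p - 4) * inner ℝ (cplxJ (xi p)) (X1 p) +
      10 * (inner ℝ (hopfQuadGrad m p) (xi p) * inner ℝ (xi p) (X1 p) -
        inner ℝ (hopfQuadGrad m p) (X1 p) * inner ℝ (xi p) (xi p)) +
      inner ℝ (hopfQuadHess m p (xi p)) (cplxJ (X1 p)) -
      inner ℝ (hopfQuadHess m p (X1 p)) (cplxJ (xi p)) =
      6 * (_ * inner ℝ (X2 p) (xi p) - inner ℝ (X2 p) (cplxJ (hopfQuadGrad m p)))
    rw [hHx, ← hX, hX', hxi, inner_neg_left, inner_neg_right, inner_neg_right, hH, h00,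
      h20, h01, hJ2, hp1]
    ring

end Field

/-! ### KKPS fields, conservation of speed and invariance under isometries. -/

theorem cos_hopfS_sq (p : S3) : Real.cos (hopfS p) ^ 2 = p.1 0 ^ 2 + p.1 1 ^ 2 := by
  have h : ‖z1 p‖ ^ 2 = p.1 0 ^ 2 + p.1 1 ^ 2 := by
    rw [← Complex.normSq_eq_norm_sq, Complex.normSq_apply, z1]; ring
  have h1 : ‖z1 p‖ ≤ 1 := by
    nlinarith [sq_sum p, sq_nonneg (p.1 2), sq_nonneg (p.1 3), norm_nonneg (z1 p)]
  rw [hopfS, Real.cos_arccos (by linarith [norm_nonneg (z1 p)]) h1, h]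

/-- With two equal coefficients, `∑ hᵢ² = 1` turns the quartic into a function of `h₂ = 2 cos² s -
1` alone, and `J σ₂ x` is the anti-Hopf field. -/
theorem isKKPS_hopfField {F : ℝ → ℝ} (hF : ContDiff ℝ ∞ F) (α γ : ℝ) :
    IsKKPS (fun p : S3 => hopfField F ![α, α, γ] p) := by
  refine ⟨fun c => F (α + (γ - α) * (2 * c - 1) ^ 2) + 4 * (γ - α) * (2 * c - 1) ^ 2,
    fun c => -4 * (γ - α) * (2 * c - 1), ?_, by fun_prop, fun p => ?_⟩
  · exact (hF.comp (by fun_prop)).add (by fun_prop)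
  have hp := sq_sum p
  have hz : 2 * (p.1 0 ^ 2 + p.1 1 ^ 2) - 1 = hopf 2 (p : E4) := by
    rw [hopf_two]; linear_combination hp
  have hxy : hopf 0 (p : E4) ^ 2 + hopf 1 (p : E4) ^ 2 = 1 - hopf 2 (p : E4) ^ 2 := by
    rw [hopf_zero, hopf_one, hopf_two]
    linear_combination (p.1 0 ^ 2 + p.1 1 ^ 2 + p.1 2 ^ 2 + p.1 3 ^ 2 + 1) * hp
  have hG : hopfQuad ![α, α, γ] (p : E4) = α + (γ - α) * hopf 2 (p : E4) ^ 2 := by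
    simp [hopfQuad, Fin.sum_univ_three]
    linear_combination α * hxy
  -- The identity `∑ hᵢ σᵢ x = |x|² x` at `|x| = 1`.
  have hsum : hopf 0 (p : E4) • pauli 0 p + hopf 1 (p : E4) • pauli 1 p =
      (p : E4) - hopf 2 (p : E4) • pauli 2 p := by
    rw [hopf_zero, hopf_one, hopf_two]
    obtain ⟨p, _⟩ := p
    simp only at hp
    ext j
    fin_cases j <;> simp [pauli_apply]
    · linear_combination p 0 * hp
    · linear_combination p 1 * hp
    · linear_combination p 2 * hp
    · linear_combination p 3 * hp
  have hg : hopfQuadGrad ![α, α, γ] (p : E4) =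
      (4 * α) • (p : E4) + (4 * (γ - α) * hopf 2 (p : E4)) • pauli 2 p := by
    have : hopfQuadGrad ![α, α, γ] (p : E4) =
        (4 * α) • (hopf 0 (p : E4) • pauli 0 p + hopf 1 (p : E4) • pauli 1 p) +
          (4 * γ * hopf 2 (p : E4)) • pauli 2 p := by
      simp [hopfQuadGrad, Fin.sum_univ_three, mul_smul]
    rw [this, hsum]
    module
  have hxi' : xi' p = cplxJ (pauli 2 p) := by
    ext j; fin_cases j <;> simp [xi', cplxJ_apply, pauli_apply]
  beta_reduce
  rw [cos_hopfS_sq, hz, hopfField, hg, hG, hxi', xi_eq, map_add, map_smul, map_smul]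
  module

/-- A KKPS field preserves its speed. -/
theorem IsKKPS.contMDiff_norm_sq {v : S3 → E4} (hv : IsKKPS v) :
    ContMDiff (𝓡 3) 𝓘(ℝ, ℝ) ∞ (fun q => ‖v q‖ ^ 2) ∧
      ∀ p, sphereD (fun q => ‖v q‖ ^ 2) p (v p) = 0 := by
  obtain ⟨A, B, hA, hB, hv⟩ := hv
  -- The cross term is `⟪ξ, ξ'⟫ = |z₁|² - |z₂|²`. The speed depends on `|z₁|²` only, and both `ξ`
  -- and `ξ'` preserve it.
  let h : ℝ → ℝ := fun c => A c ^ 2 + B c ^ 2 + 2 * A c * B c * (2 * c - 1)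
  have hh : ContDiff ℝ ∞ h := by fun_prop
  let c : E4 → ℝ := fun x => x 0 ^ 2 + x 1 ^ 2
  have hc : ContDiff ℝ ∞ c := by fun_prop
  have hn : ∀ q : S3, ‖v q‖ ^ 2 = h (c q) := by
    intro q
    have hq := sq_sum q
    rw [hv, cos_hopfS_sq, norm_sq_E4]
    simp [xi, xi', h, c]
    generalize A (q.1 0 ^ 2 + q.1 1 ^ 2) = α
    generalize B (q.1 0 ^ 2 + q.1 1 ^ 2) = β
    linear_combination (α ^ 2 + β ^ 2 - 2 * α * β) * hq
  refine ⟨contMDiff_restrict hn (hh.comp hc), fun p => ?_⟩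
  have ht : inner ℝ (p : E4) (v p) = 0 := by
    rw [hv, inner_E4]; simp [xi, xi']; ring
  have hd (i : Fin 4) : HasFDerivAt (fun x : E4 => x i) (EuclideanSpace.proj i : E4 →L[ℝ] ℝ) p :=
    (EuclideanSpace.proj i : E4 →L[ℝ] ℝ).hasFDerivAt
  have hcd : HasFDerivAt c _ (p : E4) := ((hd 0).pow 2).add ((hd 1).pow 2)
  have hhd := ((hh.differentiable (by simp)).differentiableAt
    (x := c p)).hasDerivAt.comp_hasFDerivAt (p : E4) hcd
  rw [sphereD_restrict hn hhd, tangentProj_of_tangent ht, hv]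
  simp [xi, xi']
  ring

theorem conserved_of_isometricallyRelated {u v : S3 → E4}
    (hu : ∀ p : S3, inner ℝ (p : E4) (u p) = 0) (hv : IsKKPS v)
    (h : IsometricallyRelated u v) (p : S3) : sphereD (fun q => ‖u q‖ ^ 2) p (u p) = 0 := by
  obtain ⟨Φ, hΦ, huv⟩ := h
  obtain ⟨hs, hc⟩ := hv.contMDiff_norm_sq
  have hn : (fun q => ‖u q‖ ^ 2) = fun q => ‖v (Φ q)‖ ^ 2 := by
    funext q
    rw [← huv, ← real_inner_self_eq_norm_sq, ← real_inner_self_eq_norm_sq,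
      hΦ q _ _ (hu q) (hu q)]
  rw [hn, sphereD_comp hs Φ.contMDiff, huv, hc]

/-! ### Linear isometries and the quarter turn for `a = 1`. -/

/-- The diffeomorphism of `S³` induced by a linear isometry of `ℝ⁴`. -/
noncomputable def sphereDiffeo (T : E4 ≃ₗᵢ[ℝ] E4) : S3 ≃ₘ^∞⟮𝓡 3, 𝓡 3⟯ S3 :=
  have : Fact (Module.finrank ℝ E4 = 3 + 1) := ⟨finrank_euclideanSpace_fin⟩
  { toFun := fun p => ⟨T p, by simp⟩
    invFun := fun p => ⟨T.symm p, by simp⟩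
    left_inv := fun p => by simp
    right_inv := fun p => by simp
    contMDiff_toFun := (T.contDiff.contMDiff.comp (contMDiff_coe_sphere (n := 3))).codRestrict_sphere
      (n := 3) _
    contMDiff_invFun :=
      (T.symm.contDiff.contMDiff.comp (contMDiff_coe_sphere (n := 3))).codRestrict_sphere
      (n := 3) _ }

theorem sphereDiffeo_coe (T : E4 ≃ₗᵢ[ℝ] E4) (p : S3) : (sphereDiffeo T p : E4) = T p := rfl

theorem sphereD_sphereDiffeo (T : E4 ≃ₗᵢ[ℝ] E4) {p : S3} {w : E4}
    (hw : inner ℝ (p : E4) w = 0) : sphereD (fun q => (sphereDiffeo T q : E4)) p w = T w := by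
  rw [sphereD_restrict (sphereDiffeo_coe T) T.toContinuousLinearEquiv.hasFDerivAt,
    tangentProj_of_tangent hw]
  rfl

theorem isIsometry_sphereDiffeo (T : E4 ≃ₗᵢ[ℝ] E4) : IsIsometry (sphereDiffeo T) := by
  intro p v w hv hw
  rw [sphereD_sphereDiffeo T hv, sphereD_sphereDiffeo T hw, T.inner_map_map]

theorem inv_sqrt_two_mul_self : (√2)⁻¹ * (√2)⁻¹ = (1 / 2 : ℝ) := by
  rw [← mul_inv, Real.mul_self_sqrt (by norm_num)]; norm_num

theorem cplxJ_pauli_zero_sq (x : E4) : cplxJ (pauli 0 (cplxJ (pauli 0 x))) = -x := by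
  ext j
  fin_cases j <;> simp [cplxJ_apply, pauli_apply]

theorem norm_add_cplxJ_pauli_zero_sq (x : E4) : ‖x + cplxJ (pauli 0 x)‖ ^ 2 = 2 * ‖x‖ ^ 2 := by
  rw [norm_sq_E4, norm_sq_E4]
  simp [cplxJ_apply, pauli_apply]
  ring

/-- The unitary map `2^{-1/2} (1 + i σ₁)`, which covers a quarter turn about the first axis. -/
noncomputable def quarterTurn : E4 ≃ₗᵢ[ℝ] E4 where
  toFun x := (√2)⁻¹ • (x + cplxJ (pauli 0 x))
  invFun x := (√2)⁻¹ • (x - cplxJ (pauli 0 x))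
  map_add' x y := by simp only [map_add]; module
  map_smul' c x := by simp only [map_smul, RingHom.id_apply]; module
  left_inv x := by
    simp only [map_add, map_smul, cplxJ_pauli_zero_sq, ← smul_sub, smul_smul,
      inv_sqrt_two_mul_self]
    module
  right_inv x := by
    simp only [map_sub, map_smul, cplxJ_pauli_zero_sq, ← smul_add, smul_smul,
      inv_sqrt_two_mul_self]
    module
  norm_map' x := by
    change ‖(√2)⁻¹ • (x + cplxJ (pauli 0 x))‖ = ‖x‖
    rw [← sq_eq_sq₀ (norm_nonneg _) (norm_nonneg _), norm_smul, mul_pow,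
      norm_add_cplxJ_pauli_zero_sq, Real.norm_eq_abs, sq_abs, sq, inv_sqrt_two_mul_self]
    ring

theorem quarterTurn_apply (x : E4) :
    quarterTurn x = (√2)⁻¹ • (x + cplxJ (pauli 0 x)) := rfl

/-- The turn commutes with `J` and carries the coefficients `(1, 0, 1)` to `(1, 1, 0)`. The image of
`h₁` has coefficient zero and need not be computed. -/
theorem quarterTurn_hopfField (F : ℝ → ℝ) (x : E4) :
    quarterTurn (hopfField F (psiCoeff 1) x) = hopfField F ![1, 1, 0] (quarterTurn x) := by
  have h := inv_sqrt_two_mul_self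
  have hm : psiCoeff 1 = ![1, 0, 1] := by simp [psiCoeff]
  have h0 : hopf 0 (quarterTurn x) = hopf 0 x := by
    simp [quarterTurn_apply, hopf_zero, cplxJ_apply, pauli_apply]
    linear_combination 2 * (x 0 * x 2 + x 1 * x 3) * h
  have h1 : hopf 1 (quarterTurn x) = -hopf 2 x := by
    simp [quarterTurn_apply, hopf_one, hopf_two, cplxJ_apply, pauli_apply]
    linear_combination -2 * (x 0 ^ 2 + x 1 ^ 2 - x 2 ^ 2 - x 3 ^ 2) * h
  have hG : hopfQuad ![1, 1, 0] (quarterTurn x) = hopfQuad ![1, 0, 1] x := by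
    simp [hopfQuad, Fin.sum_univ_three, h0, h1]
  have hJ : ∀ y, quarterTurn (cplxJ y) = cplxJ (quarterTurn y) := fun y => by
    simp [quarterTurn_apply, cplxJ_pauli]
  have hp0 : pauli 0 (quarterTurn x) = quarterTurn (pauli 0 x) := by
    simp [quarterTurn_apply, cplxJ_pauli]
  have hp1 : pauli 1 (quarterTurn x) = -quarterTurn (pauli 2 x) := by
    rw [quarterTurn_apply, quarterTurn_apply]
    ext j
    fin_cases j <;> simp [cplxJ_apply, pauli_apply] <;> ring
  have hg : hopfQuadGrad ![1, 1, 0] (quarterTurn x) = quarterTurn (hopfQuadGrad ![1, 0, 1] x) := by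
    simp [hopfQuadGrad, Fin.sum_univ_three, h0, h1, hp0, hp1]
  rw [hm, hopfField, hopfField, hG, hg, map_sub, map_smul, hJ, hJ]

end SphereEuler

/-! ### The proposition. -/

theorem mainTheorem2 (F : ℝ → ℝ) (hF : ContDiff ℝ ∞ F) (a : ℝ) (ha : 0 ≤ a) :
    -- (i) steady Euler field with Bernoulli function `b`
    (IsSteadyEuler (field F a) ∧
      IsBernoulli (field F a) (bernoulliFn F a) ∧
      (∀ p, cross p (field F a p) (curl (field F a) p) = grad (bernoulliFn F a) p) ∧
      ((∀ x, F x = 2 * (3 * x - 2)) → IsCurlEigenfield (field F a) 6)) ∧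
    -- (ii) the KKPS members of the family
    ((a = 0 → IsKKPS (field F a)) ∧
      (a = 1 → ∃ v : S3 → E4, IsKKPS v ∧ IsSteadyEuler v ∧
        IsometricallyRelated (field F a) v)) ∧
    -- (iii) the other members are not localizable, hence not isometric to a KKPS field
    (a ≠ 0 → a ≠ 1 → ¬ IsLocalizable (field F a) ∧
      ¬ ∃ v : S3 → E4, IsKKPS v ∧ IsometricallyRelated (field F a) v) := by
  have hu : field F a = fun p : S3 => hopfField F (psiCoeff a) p := funext (field_eq F a)
  have hm : ∑ i, psiCoeff a i = 2 := by simp [psiCoeff, Fin.sum_univ_three]; ring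
  have hvec := isVectorField_hopfField hF (psiCoeff a)
  have hπ := isPressure_hopfPressure hF (psiCoeff a)
  have hb : ∀ p : S3, bernoulliFn F a p =
      hopfPressure F (psiCoeff a) p + 1 / 2 * ‖hopfField F (psiCoeff a) p‖ ^ 2 := by
    intro p
    rw [norm_sq_hopfField, norm_eq_of_mem_sphere p, bernoulliFn, hopfPressure, psi_eq_hopfQuad, hm]
    ring
  rw [hu]
  refine ⟨⟨isSteadyEuler_hopfField hF _, ⟨_, hπ, hb⟩, cross_curl_eq_grad hvec hπ hb,
    fun hF' => ⟨hvec, fun h0 => ?_, curl_hopfField hF _ hm hF'⟩⟩,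
    ⟨fun h => ?_, fun h => ?_⟩, fun h0 h1 => ?_⟩
  -- At this point `ψ = 1`, `F = 2` and the gradient of `ψ` on the sphere vanishes, so the field
  -- equals `2ξ ≠ 0`.
  · let p : S3 := ⟨EuclideanSpace.single 0 1, by simp⟩
    have h := congrArg (fun y : E4 => y 1) (congrFun h0 p)
    simp [p, hopfField, hopfQuadGrad, hopfQuad, cplxJ_apply, pauli_apply, hopf_zero, hopf_one,
      hopf_two, Fin.sum_univ_three, psiCoeff, hF'] at h
    norm_num at h
  · have : psiCoeff a = ![1 / 2, 1 / 2, 1] := by simp [psiCoeff, h]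
    rw [this]
    exact isKKPS_hopfField hF _ _
  · refine ⟨fun p : S3 => hopfField F ![1, 1, 0] p, isKKPS_hopfField hF _ _,
      isSteadyEuler_hopfField hF _, sphereDiffeo quarterTurn, isIsometry_sphereDiffeo _,
      fun p => ?_⟩
    rw [sphereD_sphereDiffeo _ (hvec.tangent p), h]
    exact quarterTurn_hopfField F p
  -- A rational point with all Hopf components nonzero: `(8/9, -4/9, -1/9)`.
  · have hp : ‖(!₂[2 / 3, 0, 2 / 3, 1 / 3] : E4)‖ = 1 := by
      rw [← sq_eq_sq₀ (norm_nonneg _) zero_le_one, norm_sq_E4]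
      simp; norm_num
    let p : S3 := ⟨!₂[2 / 3, 0, 2 / 3, 1 / 3], by simpa using hp⟩
    have hne : sphereD (fun q : S3 => ‖hopfField F (psiCoeff a) q‖ ^ 2) p
        (hopfField F (psiCoeff a) p) ≠ 0 := by
      have h2 : 1 + a ≠ 0 := by linarith
      have h3 : 1 - a ≠ 0 := sub_ne_zero.2 h1.symm
      have : sphereD (fun q : S3 => ‖hopfField F (psiCoeff a) q‖ ^ 2) p
        (hopfField F (psiCoeff a) p) = -(2048 / 729) * (a * (1 + a) * (1 - a)) := by
        rw [sphereD_norm_sq_hopfField hF]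
        simp [p, psiCoeff, hopf_zero, hopf_one, hopf_two]
        ring
      rw [this]
      positivity
    exact ⟨fun hl => hne (hl.conserved p), fun ⟨v, hv, hr⟩ =>
      hne (conserved_of_isometricallyRelated hvec.tangent hv hr p)⟩
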